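/- Let $p$ be an odd prime, $|\cdot|_p$ the $p$-adic absolute value on $\mathbb{Q}_p$. For $s\ge 0$ let $T_s(z)=T_s(z_1,z_2,z_3)\in\mathbb{Z}[z_1,z_2,z_3]$ be the coefficient of $t^{p^s-1}$ in the polynomial $\big((t-z_1)(t-z_2)(t-z_3)\big)^{(p^s-1)/2}$, let $\bar T_s=(-1)^{(p^s-1)/2}\,T_s$, so that $$\bar T_s(z)=\sum_{k_1+k_2+k_3=(p^s-1)/2}\ \prod_{i=1}^{3}\binom{(p^s-1)/2}{k_i}z_i^{k_i},$$ and let $\mathfrak D=\{z\in\mathbb{Z}_p^3 : |\bar T_1(z)|_p=1\}$. Write $z^p=(z_1^p,z_2^p,z_3^p)$. Theorem. (i) For every $s\ge 1$ the rational function $\bar T_{s+1}(z)/\bar T_s(z^p)$ is regular on $\mathfrak D$; indeed $\bar T_s(z^p)\neq 0$ for all $z\in\mathfrak D$. (ii) The sequence $\big(\bar T_{s+1}(z)/\bar T_s(z^p)\big)_{s\ge1}$ converges uniformly on $\mathfrak D$ to a function $f:\mathfrak D\to\mathbb{Q}_p$. The function $f$ is analytic: for every $a\in\mathfrak D$ it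 is given by a convergent power series in $z-a$ on the whole polydisc $\{z : |z_i-a_i|_p<1,\ i=1,2,3\}$ (which is contained in $\mathfrak D$). Moreover $|f(z)|_p=1$ for every $z\in\mathfrak D$. (iii) Let $F(x)={}_2F_1(1/2,1/2;1;x)=\sum_{k\ge0}\binom{-1/2}{k}^2x^k$. For every $x\in\mathbb{Z}_p$ with $|x|_p<1$, the point $(1,x,0)$ lies in $\mathfrak D$, the series $F(x)$ converges in $\mathbb{Q}_p$, $F(x^p)\ne 0$, and $$f(1,x,0)=\frac{F(x)}{F(x^p)}.$$ -/

import Mathlib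

noncomputable section

/-- The master polynomial `Φ_s(t, z) = ((t - z₁)(t - z₂)(t - z₃))^((p^s - 1)/2)`, as a polynomial
in `t` with coefficients in `ℤ[z₁, z₂, z₃]`. (The natural number division is exact for odd `p`.) -/
def masterPoly (p s : ℕ) : Polynomial (MvPolynomial (Fin 3) ℤ) :=
  (∏ i : Fin 3, (Polynomial.X - Polynomial.C (MvPolynomial.X i))) ^ ((p ^ s - 1) / 2)

/-- The approximation polynomial `T_s(z)`: the coefficient of `t^(p^s - 1)` in the master
polynomial `Φ_s(t, z)`. -/
def approxPoly (p s : ℕ) : MvPolynomial (Fin 3) ℤ :=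
  (masterPoly p s).coeff (p ^ s - 1)

/-- `T̄_s(z) = (-1)^((p^s - 1)/2) T_s(z)`. -/
def approxPolyBar (p s : ℕ) : MvPolynomial (Fin 3) ℤ :=
  (-1) ^ ((p ^ s - 1) / 2) * approxPoly p s

/-- The value of `T̄_s` at a point `z ∈ ℚ_p³`. -/
def evalTBar (p : ℕ) [Fact p.Prime] (s : ℕ) (z : Fin 3 → ℚ_[p]) : ℚ_[p] :=
  MvPolynomial.aeval z (approxPolyBar p s)

/-- The domain `𝔇 = {z ∈ ℤ_p³ : |T̄_1(z)|_p = 1}`, as a subset of `ℚ_p³`. -/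
def domainD (p : ℕ) [Fact p.Prime] : Set (Fin 3 → ℚ_[p]) :=
  {z | (∀ i, ‖z i‖ ≤ 1) ∧ ‖evalTBar p 1 z‖ = 1}

/-- The function `z ↦ T̄_{s+1}(z) / T̄_s(z^p)`, where `z^p = (z₁^p, z₂^p, z₃^p)`. -/
def ratioT (p : ℕ) [Fact p.Prime] (s : ℕ) (z : Fin 3 → ℚ_[p]) : ℚ_[p] :=
  evalTBar p (s + 1) z / evalTBar p s (fun i => z i ^ p)

/-- `F(x) = ₂F₁(1/2, 1/2; 1; x)`, the sum of the hypergeometric series over `ℚ_p`. -/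
def hypF (p : ℕ) [Fact p.Prime] (x : ℚ_[p]) : ℚ_[p] :=
  ordinaryHypergeometric (1 / 2 : ℚ_[p]) (1 / 2 : ℚ_[p]) (1 : ℚ_[p]) x

end

/-! Everything rests on a Dwork congruence in `ℤ[z]`: with σ the Frobenius lift `z_i ↦ z_i ^ p`,
`T̄_{s+1} · σ T̄_{s-1} ≡ T̄_s · σ T̄_s` modulo `p ^ s`.

To get it, extend σ to `ℤ[z][t]` by `t ↦ t ^ p`. The signed master polynomials satisfy `A (a + b) =
A a * A b ^ p ^ a`. Because `x ^ p ≡ σ x` modulo `p`, the power `A b ^ p ^ a` is p-adically close to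
a Frobenius twist, and `A n` decomposes as a sum of blocks `V_k * σ^[k+1] (A (n-k-1))` with `p ^ k ∣
V_k` (`pow_dvd_uncutPart`). The `t`-degree of a block is so small that taking the coefficient of `t
^ (p ^ n - 1)` is multiplicative on each term (`coeff_mul_iterate_polyFrob`). Hence `T̄` obeys a
twisted convolution recursion whose kernel is divisible by `p ^ k`, and such a recursion forces the
congruence (`pow_dvd_of_twisted_recursion`).

Modulo `p` the recursion reads `T̄_{s+1} ≡ T̄_1 · σ T̄_s`, so every `T̄_s` is a unit on 𝔇. Dividing
the congruence by units makes the ratios Cauchy with a bound independent of `z`. The same division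
carried out on expansions in `ℤ_p[[z - a]]` makes the power series converge coefficientwise, and
integral coefficients give radius of convergence at least 1.

At `(1, x, 0)`, `T̄_s` is `∑ (m choose k) ^ 2 * x ^ k` with `m = (p ^ s - 1) / 2`, and `m → -1/2` in
`ℚ_p`; dominated convergence gives the limit `F(x)`. -/

open Finset Filter Topology

/-! ### Dwork congruences from a Frobenius lift on a commutative ring -/

section Frobenius

variable {S : Type*} [CommRing S] (σ : S →+* S) (A : ℕ → S)

/-- The part of `A n` that remains after splitting off, at every `k ≤ l`, the terms that factor
as a product of an irreducible block of length `k` and a Frobenius twist of `A (n - k)`. -/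
def uncutPart : ℕ → ℕ → S
  | 0, n => A n
  | l + 1, n => uncutPart l n - uncutPart l (l + 1) * σ^[l + 1] (A (n - (l + 1)))

/-- The last term split off has the factor `A 0 = 1`, so it equals all that remained. -/
theorem uncutPart_self (h0 : A 0 = 1) {n : ℕ} (hn : n ≠ 0) : uncutPart σ A n n = 0 := by
  obtain ⟨l, rfl⟩ := Nat.exists_eq_succ_of_ne_zero hn
  simp [uncutPart, h0, iterate_map_one]

theorem uncutPart_eq_sub_sum (l n : ℕ) :
    uncutPart σ A l n =
      A n - ∑ k ∈ range l, uncutPart σ A k (k + 1) * σ^[k + 1] (A (n - (k + 1))) := by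
  induction l with
  | zero => simp [uncutPart]
  | succ l ih => rw [uncutPart, ih, sum_range_succ]; ring

theorem eq_sum_uncutPart (h0 : A 0 = 1) {n : ℕ} (hn : n ≠ 0) :
    A n = ∑ k ∈ range n, uncutPart σ A k (k + 1) * σ^[k + 1] (A (n - (k + 1))) := by
  have := uncutPart_eq_sub_sum σ A n n
  rw [uncutPart_self σ A h0 hn] at this
  exact (sub_eq_zero.mp this.symm)

/-- Summation by parts: the multiplicative relation turns the terms split off from `A (l + b)` into
those split off from `A l`, weighted by twisted powers of `A b`; only differences of consecutive
weights survive, besides a boundary term. -/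
theorem uncutPart_add {p : ℕ} (hA : ∀ a b, A (a + b) = A a * A b ^ p ^ a) (l b m : ℕ)
    (hm : m ≤ l) :
    uncutPart σ A m (l + b) =
      ∑ e ∈ range m, uncutPart σ A e l *
        (σ^[e] (A b ^ p ^ (l - e)) - σ^[e + 1] (A b ^ p ^ (l - (e + 1)))) +
      uncutPart σ A m l * σ^[m] (A b ^ p ^ (l - m)) := by
  induction m with
  | zero => simp [uncutPart, hA]
  | succ m ih =>
    rw [uncutPart, ih (by omega), sum_range_succ, uncutPart]
    have : l + b - (m + 1) = (l - (m + 1)) + b := by omega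
    rw [this, hA, iterate_map_mul]
    ring

theorem iterate_dvd {d : ℕ} {x : S} (h : (d : S) ∣ x) (k : ℕ) : (d : S) ∣ σ^[k] x := by
  obtain ⟨c, rfl⟩ := h
  rw [iterate_map_mul]
  have : σ^[k] (d : S) = d := by
    induction k with
    | zero => rfl
    | succ k ih => rw [Function.iterate_succ_apply', ih, map_natCast]
  rw [this]
  exact dvd_mul_right _ _

/-- In `uncutPart_add` with `m = l` the boundary term vanishes. The `e`-th summand gets `p ^ e` by
induction and `p ^ (l - e)` from its difference of weights, since `x ≡ y` modulo `p` gives `x ^ p ^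
c ≡ y ^ p ^ c` modulo `p ^ (c + 1)`. -/
theorem pow_dvd_uncutPart {p : ℕ} (h0 : A 0 = 1) (hA : ∀ a b, A (a + b) = A a * A b ^ p ^ a)
    (hσ : ∀ x, (p : S) ∣ x ^ p - σ x) (l n : ℕ) (hl : l ≤ n) :
    ((p ^ l : ℕ) : S) ∣ uncutPart σ A l n := by
  induction l using Nat.strong_induction_on generalizing n with
  | _ l ih =>
    rcases eq_or_ne l 0 with rfl | hl0
    · simp
    obtain ⟨b, rfl⟩ := Nat.exists_eq_add_of_le hl
    rw [uncutPart_add σ A hA l b l le_rfl, uncutPart_self σ A h0 hl0, zero_mul, add_zero]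
    refine dvd_sum fun e he => ?_
    have he : e < l := mem_range.mp he
    have hsplit : p ^ l = p ^ e * p ^ (l - e) := by rw [← pow_add]; congr 1; omega
    rw [hsplit, Nat.cast_mul]
    refine mul_dvd_mul (ih e he l he.le) ?_
    rw [Function.iterate_succ_apply, ← iterate_map_sub]
    refine iterate_dvd σ ?_ e
    obtain ⟨c, hc⟩ : ∃ c, l - e = c + 1 := ⟨l - e - 1, by omega⟩
    have hc' : l - (e + 1) = c := by omega
    rw [hc, hc', pow_succ' p c, pow_mul, map_pow, ← pow_succ', Nat.cast_pow]
    exact dvd_sub_pow_of_dvd_sub (hσ _) c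

/-- A sequence with a Frobenius-twisted convolution recursion whose kernel is increasingly
divisible by `p` satisfies Dwork congruences. -/
theorem pow_dvd_of_twisted_recursion {p : ℕ} {T I : ℕ → S}
    (hI : ∀ k, ((p ^ k : ℕ) : S) ∣ I k)
    (hT : ∀ n, n ≠ 0 → T n = ∑ k ∈ range n, I k * σ^[k + 1] (T (n - (k + 1))))
    (a m : ℕ) (hm : 1 ≤ m) (hma : m < a) :
    ((p ^ (a - m) : ℕ) : S) ∣
      T a * σ^[m] (T (a - 1 - m)) - T (a - 1) * σ^[m] (T (a - m)) := by
  induction a using Nat.strong_induction_on generalizing m with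
  | _ a ih =>
    obtain ⟨a, rfl⟩ : ∃ c, a = c + 1 := ⟨a - 1, by omega⟩
    simp only [Nat.add_sub_cancel]
    have ha : a ≠ 0 := by omega
    rw [hT (a + 1) (by omega), hT a ha, sum_range_succ, add_mul, sum_mul, sum_mul,
      add_sub_right_comm, ← sum_sub_distrib]
    refine dvd_add (dvd_sum fun k hk => ?_) ?_
    · have hk : k < a := mem_range.mp hk
      rw [mul_assoc, mul_assoc, ← mul_sub]
      -- For `k + 1 < m` the bracket is `σ^[k+1]` of a smaller instance with the same exponent. For
      -- `k + 1 = m` it cancels. For `k + 1 > m` it is, up to sign, `σ^[m]` of an instance with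
      -- exponent `a - k`, which the factor `p ^ k` of `I k` completes to `p ^ a`. The change of
      -- twist is why `m` must be arbitrary.
      rcases lt_trichotomy (k + 1) m with h | h | h
      · refine Dvd.dvd.mul_left ?_ _
        have := ih (a + 1 - (k + 1)) (by omega) (m - (k + 1)) (by omega) (by omega)
        have e1 : a + 1 - (k + 1) - (m - (k + 1)) = a + 1 - m := by omega
        have e2 : a + 1 - (k + 1) - 1 = a - (k + 1) := by omega
        have e3 : a - (k + 1) - (m - (k + 1)) = a - m := by omega
        rw [e2, e3, e1] at this
        have e4 : m = (k + 1) + (m - (k + 1)) := by omega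
        have := iterate_dvd σ this (k + 1)
        rw [iterate_map_sub, iterate_map_mul, iterate_map_mul, ← Function.iterate_add_apply,
          ← Function.iterate_add_apply, ← e4] at this
        exact this
      · subst h
        rw [mul_comm (σ^[k + 1] (T (a + 1 - (k + 1)))), sub_self, mul_zero]
        exact dvd_zero _
      · have := ih (a + 1 - m) (by omega) (k + 1 - m) (by omega) (by omega)
        have e1 : a + 1 - m - (k + 1 - m) = a + 1 - (k + 1) := by omega
        have e2 : a + 1 - m - 1 = a - m := by omega
        have e3 : a - m - (k + 1 - m) = a - (k + 1) := by omega
        rw [e2, e3, e1] at this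
        have e4 : k + 1 = m + (k + 1 - m) := by omega
        have := iterate_dvd σ this m
        rw [iterate_map_sub, iterate_map_mul, iterate_map_mul, ← Function.iterate_add_apply,
          ← Function.iterate_add_apply, ← e4] at this
        have h2 := mul_dvd_mul (hI k) this
        rw [← Nat.cast_mul, ← pow_add] at h2
        have h3 : ((p ^ (a + 1 - m) : ℕ) : S) ∣ ((p ^ (k + (a + 1 - (k + 1))) : ℕ) : S) :=
          Nat.cast_dvd_cast (pow_dvd_pow p (by omega))
        exact (h3.trans h2).trans ⟨-1, by ring⟩
    · refine ((Nat.cast_dvd_cast (pow_dvd_pow p (by omega))).trans (hI a)).trans ?_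
      rw [mul_assoc]
      exact dvd_mul_right _ _

end Frobenius

/-! ### The Frobenius lift on `R[t]` and coefficient extraction -/

section PolynomialFrobenius

open Polynomial

variable {R : Type*} [CommRing R] (p : ℕ) (φ : R →+* R)

/-- The extension of `φ : R →+* R` to `R[t]` sending `t` to `t ^ p`. -/
noncomputable def polyFrob : R[X] →+* R[X] :=
  (expand R p : R[X] →+* R[X]).comp (mapRingHom φ)

theorem polyFrob_apply (f : R[X]) : polyFrob p φ f = expand R p (f.map φ) := rfl

theorem iterate_polyFrob (k : ℕ) (f : R[X]) :
    (polyFrob p φ)^[k] f = expand R (p ^ k) (f.map (φ ^ k)) := by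
  induction k with
  | zero =>
    have : (1 : R →+* R) = RingHom.id R := rfl
    simp [this]
  | succ k ih =>
    have : φ ^ (k + 1) = φ.comp (φ ^ k) := pow_succ' φ k
    rw [Function.iterate_succ_apply', ih, polyFrob_apply, Polynomial.map_expand, expand_expand,
      Polynomial.map_map, pow_succ' p k, this]

theorem natDegree_iterate_polyFrob_le (k : ℕ) (f : R[X]) :
    ((polyFrob p φ)^[k] f).natDegree ≤ p ^ k * f.natDegree := by
  rw [iterate_polyFrob, natDegree_expand, mul_comm]
  exact Nat.mul_le_mul_left _ natDegree_map_le

/-- With `q = p ^ k`, the twisted factor only has exponents `q * m`. Then `m > n` overshoots, while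
`m < n` requires from `f` an exponent at least `2 * q - 1`, above its degree; only `m = n` remains.
-/
theorem coeff_mul_iterate_polyFrob (hp : 0 < p) {k : ℕ} {f : R[X]}
    (hf : f.natDegree < 2 * p ^ k - 1) (g : R[X]) (n : ℕ) :
    (f * (polyFrob p φ)^[k] g).coeff (p ^ k * (n + 1) - 1) =
      f.coeff (p ^ k - 1) * φ^[k] (g.coeff n) := by
  have hq : 0 < p ^ k := pow_pos hp k
  have hφ : ∀ x, (φ ^ k) x = φ^[k] x := fun x => by rw [RingHom.coe_pow]
  rw [iterate_polyFrob]
  set q := p ^ k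
  rw [coeff_mul, sum_eq_single (q - 1, q * n)]
  · rw [mul_comm q n, coeff_expand_mul hq, coeff_map, hφ]
  · rintro ⟨i, j⟩ hij hne
    rw [HasAntidiagonal.mem_antidiagonal] at hij
    simp only at hij ⊢
    rw [coeff_expand hq]
    split_ifs with h
    · obtain ⟨m, rfl⟩ := h
      rw [coeff_eq_zero_of_natDegree_lt, zero_mul]
      have hmn : m ≠ n := by
        rintro rfl
        apply hne
        rw [mul_add] at hij
        simp only [Prod.mk.injEq, and_true]
        omega
      have hlt : m < n := by
        by_contra hcon
        have : n + 1 ≤ m := by omega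
        have := Nat.mul_le_mul_left q this
        have : 0 < q * (n + 1) := by positivity
        omega
      have h1 := Nat.mul_le_mul_left q (show m + 2 ≤ n + 1 by omega)
      rw [mul_add] at h1
      omega
    · rw [mul_zero]
  · intro h
    exfalso
    apply h
    rw [HasAntidiagonal.mem_antidiagonal, mul_add]
    simp only
    omega

theorem dvd_pow_sub_polyFrob [Fact p.Prime] (hφ : ∀ x, (p : R) ∣ x ^ p - φ x) (f : R[X]) :
    (p : R[X]) ∣ f ^ p - polyFrob p φ f := by
  induction f using Polynomial.induction_on' with
  | add f g hf hg =>
    have h : (p : R[X]) ∣ (f + g) ^ p - (f ^ p + g ^ p) := by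
      obtain ⟨r, hr⟩ := exists_add_pow_prime_eq (Fact.out : p.Prime) f g
      exact ⟨f * g * r, by rw [hr]; ring⟩
    have := dvd_add h (dvd_add hf hg)
    rw [map_add]
    convert this using 1
    ring
  | monomial n a =>
    rw [polyFrob_apply, map_monomial, expand_monomial, monomial_pow, ← monomial_sub]
    obtain ⟨c, hc⟩ := hφ a
    refine ⟨monomial (n * p) c, ?_⟩
    rw [← C_eq_natCast, C_mul_monomial, ← hc]

end PolynomialFrobenius

theorem MvPolynomial.dvd_pow_sub_expand (p : ℕ) [Fact p.Prime] {ι : Type*}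
    (f : MvPolynomial ι ℤ) :
    (p : MvPolynomial ι ℤ) ∣ f ^ p - expand p f := by
  rw [← map_natCast (C : ℤ →+* MvPolynomial ι ℤ) p, C_dvd_iff_zmod]
  simp [map_expand, expand_zmod]

/-! ### The recursion and the Dwork congruence for `T̄_s` -/

section

open Polynomial

/-- The master polynomial with the sign of `T̄_s` absorbed. -/
noncomputable def signedMaster (p s : ℕ) : Polynomial (MvPolynomial (Fin 3) ℤ) :=
  (-∏ i : Fin 3, (X - C (MvPolynomial.X i))) ^ ((p ^ s - 1) / 2)

theorem coeff_signedMaster (p s : ℕ) :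
    (signedMaster p s).coeff (p ^ s - 1) = approxPolyBar p s := by
  have h (Q : Polynomial (MvPolynomial (Fin 3) ℤ)) (m : ℕ) : (-Q) ^ m = C ((-1) ^ m) * Q ^ m := by
    rw [show -Q = C (-1) * Q by rw [C_neg, C_1]; exact (neg_one_mul Q).symm, mul_pow, ← C_pow]
  rw [approxPolyBar, approxPoly, masterPoly, signedMaster, h, coeff_C_mul]

theorem half_pow_sub_one_add {p : ℕ} (hp : Odd p) (a b : ℕ) :
    (p ^ (a + b) - 1) / 2 = (p ^ a - 1) / 2 + p ^ a * ((p ^ b - 1) / 2) := by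
  obtain ⟨u, hu⟩ := hp.pow (n := a)
  obtain ⟨v, hv⟩ := hp.pow (n := b)
  rw [pow_add, hu, hv]
  have h1 : (2 * v + 1 - 1) / 2 = v := by omega
  have h2 : (2 * u + 1 - 1) / 2 = u := by omega
  have h3 : (2 * u + 1) * (2 * v + 1) = 2 * (u + (2 * u + 1) * v) + 1 := by ring
  rw [h1, h2, h3]
  omega

theorem signedMaster_add {p : ℕ} (hp : Odd p) (a b : ℕ) :
    signedMaster p (a + b) = signedMaster p a * signedMaster p b ^ p ^ a := by
  rw [signedMaster, signedMaster, signedMaster, half_pow_sub_one_add hp, pow_add, ← pow_mul,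
    mul_comm (p ^ a)]

theorem natDegree_signedMaster_le (p s : ℕ) :
    (signedMaster p s).natDegree ≤ 3 * ((p ^ s - 1) / 2) := by
  refine natDegree_pow_le.trans ?_
  rw [mul_comm, natDegree_neg]
  refine Nat.mul_le_mul_right _ ((natDegree_prod_le _ _).trans ?_)
  simp

/-- The Frobenius lift `z_i ↦ z_i ^ p` on `ℤ[z]`. -/
noncomputable def frobZ (p : ℕ) : MvPolynomial (Fin 3) ℤ →+* MvPolynomial (Fin 3) ℤ :=
  (MvPolynomial.expand p : MvPolynomial (Fin 3) ℤ →ₐ[ℤ] MvPolynomial (Fin 3) ℤ)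

/-- Splitting off terms does not raise the degree bound, because `3 * ((p ^ n - 1) / 2)` is additive
in the same twisted sense as the exponents of the master polynomials. The bound lies below `2 * p ^
n - 1`, as coefficient extraction requires. -/
theorem natDegree_uncutPart_le {p : ℕ} (hp : Odd p) (l n : ℕ) (hl : l ≤ n) :
    (uncutPart (polyFrob p (frobZ p)) (signedMaster p) l n).natDegree ≤
      3 * ((p ^ n - 1) / 2) := by
  induction l generalizing n with
  | zero => exact natDegree_signedMaster_le p n
  | succ l ih =>
    rw [uncutPart]
    refine (natDegree_sub_le _ _).trans (max_le (ih n (by omega)) ?_)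
    refine natDegree_mul_le.trans ?_
    refine (add_le_add (ih (l + 1) (by omega))
      ((natDegree_iterate_polyFrob_le p (frobZ p) _ _).trans
        (Nat.mul_le_mul_left _ (natDegree_signedMaster_le p _)))).trans ?_
    have := half_pow_sub_one_add hp (l + 1) (n - (l + 1))
    rw [show l + 1 + (n - (l + 1)) = n by omega] at this
    rw [this]
    apply le_of_eq
    ring

/-- The kernel of the convolution recursion for `T̄_s`. -/
noncomputable def blockCoeff (p k : ℕ) : MvPolynomial (Fin 3) ℤ :=
  (uncutPart (polyFrob p (frobZ p)) (signedMaster p) k (k + 1)).coeff (p ^ (k + 1) - 1)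

theorem approxPolyBar_zero (p : ℕ) : approxPolyBar p 0 = 1 := by
  simp [approxPolyBar, approxPoly, masterPoly]

theorem approxPolyBar_eq_sum {p : ℕ} (hp : Odd p) {n : ℕ} (hn : n ≠ 0) :
    approxPolyBar p n =
      ∑ k ∈ range n, blockCoeff p k * (frobZ p)^[k + 1] (approxPolyBar p (n - (k + 1))) := by
  have h := eq_sum_uncutPart (polyFrob p (frobZ p)) (signedMaster p) (by simp [signedMaster]) hn
  rw [← coeff_signedMaster]
  conv_lhs => rw [h]
  rw [finsetSum_coeff]
  refine sum_congr rfl fun k hk => ?_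
  have hk : k < n := mem_range.mp hk
  have hpos : 0 < p := hp.pos
  rw [blockCoeff, ← coeff_signedMaster, ← coeff_mul_iterate_polyFrob p (frobZ p) hpos]
  · congr 1
    rw [Nat.sub_add_cancel (pow_pos hpos _), ← pow_add]
    congr 2
    omega
  · refine (natDegree_uncutPart_le hp k (k + 1) (by omega)).trans_lt ?_
    have : 0 < p ^ (k + 1) := pow_pos hpos _
    omega

theorem pow_dvd_blockCoeff (p : ℕ) [Fact p.Prime] (hp : Odd p) (k : ℕ) :
    ((p ^ k : ℕ) : MvPolynomial (Fin 3) ℤ) ∣ blockCoeff p k := by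
  have := pow_dvd_uncutPart (polyFrob p (frobZ p)) (signedMaster p) (p := p)
    (by simp [signedMaster]) (signedMaster_add hp)
    (dvd_pow_sub_polyFrob p (frobZ p) (MvPolynomial.dvd_pow_sub_expand p)) k (k + 1) (by omega)
  rw [← C_eq_natCast, C_dvd_iff_dvd_coeff] at this
  exact this _

/-- The Dwork congruence for `T̄_s`. -/
theorem pow_dvd_approxPolyBar (p : ℕ) [Fact p.Prime] (hp : Odd p) {s : ℕ} (hs : 1 ≤ s) :
    ((p ^ s : ℕ) : MvPolynomial (Fin 3) ℤ) ∣
      approxPolyBar p (s + 1) * frobZ p (approxPolyBar p (s - 1)) -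
        approxPolyBar p s * frobZ p (approxPolyBar p s) := by
  have := pow_dvd_of_twisted_recursion (frobZ p) (T := approxPolyBar p) (pow_dvd_blockCoeff p hp)
    (fun n hn => approxPolyBar_eq_sum hp hn) (s + 1) 1 le_rfl (by omega)
  simpa using this

/-- Modulo `p` only the `k = 0` term of the recursion survives, and its kernel is `T̄_1`. -/
theorem dvd_approxPolyBar_succ_sub (p : ℕ) [Fact p.Prime] (hp : Odd p) (s : ℕ) :
    (p : MvPolynomial (Fin 3) ℤ) ∣
      approxPolyBar p (s + 1) - approxPolyBar p 1 * frobZ p (approxPolyBar p s) := by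
  have h1 : approxPolyBar p 1 = blockCoeff p 0 := by
    rw [approxPolyBar_eq_sum hp one_ne_zero]
    simp [approxPolyBar_zero]
  rw [approxPolyBar_eq_sum hp (Nat.succ_ne_zero s), sum_range_succ', h1]
  rw [zero_add, Function.iterate_one, Nat.succ_sub_one, add_sub_cancel_right]
  refine dvd_sum fun k _ => Dvd.dvd.mul_right (α := MvPolynomial (Fin 3) ℤ) ?_ _
  refine (Nat.cast_dvd_cast ?_).trans (pow_dvd_blockCoeff p hp (k + 1))
  exact dvd_pow_self p (Nat.succ_ne_zero k)

end

/-! ### Geometric convergence in ultrametric groups -/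

section Ultrametric

variable {E : Type*} [NormedAddCommGroup E] [IsUltrametricDist E]

theorem norm_add_sub_le_of_ultrametric {r : ℝ} (hr0 : 0 ≤ r) (hr1 : r ≤ 1) {u : ℕ → E}
    (hu : ∀ s, ‖u (s + 1) - u s‖ ≤ r ^ s) (s k : ℕ) : ‖u (s + k) - u s‖ ≤ r ^ s := by
  induction k with
  | zero => simpa using pow_nonneg hr0 s
  | succ k ih =>
    rw [← add_assoc, ← sub_add_sub_cancel _ (u (s + k))]
    refine (IsUltrametricDist.norm_add_le_max _ _).trans (max_le ((hu _).trans ?_) ih)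
    exact pow_le_pow_of_le_one hr0 hr1 (Nat.le_add_right _ _)

theorem exists_norm_sub_le_of_ultrametric [CompleteSpace E] {r : ℝ} (hr0 : 0 ≤ r) (hr1 : r < 1)
    {u : ℕ → E} (hu : ∀ s, ‖u (s + 1) - u s‖ ≤ r ^ s) : ∃ L, ∀ s, ‖L - u s‖ ≤ r ^ s := by
  have hc : CauchySeq u := cauchySeq_of_le_geometric r 1 hr1 fun n => by
    rw [dist_comm, dist_eq_norm, one_mul]
    exact hu n
  obtain ⟨L, hL⟩ := cauchySeq_tendsto_of_complete hc
  refine ⟨L, fun s => ?_⟩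
  have h1 : Tendsto (fun k => ‖u (s + k) - u s‖) atTop (𝓝 ‖L - u s‖) := by
    refine ((Tendsto.sub_const ?_ _)).norm
    simpa only [add_comm s] using (tendsto_add_atTop_iff_nat s).mpr hL
  exact le_of_tendsto' h1 (norm_add_sub_le_of_ultrametric hr0 hr1.le hu s)

end Ultrametric

theorem aeval_frobZ {A : Type*} [CommRing A] (z : Fin 3 → A) (g : MvPolynomial (Fin 3) ℤ) :
    MvPolynomial.aeval z (frobZ p g) = MvPolynomial.aeval (fun i => z i ^ p) g := by
  have : frobZ p g = MvPolynomial.bind₁ (fun i => MvPolynomial.X i ^ p) g := rfl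
  rw [this, MvPolynomial.aeval_bind₁]
  simp

/-! ### Unit values and uniform estimates on 𝔇 -/

section Evaluation

variable {p : ℕ} [Fact p.Prime]

theorem padicInt_coe_aeval {ι : Type*} (w : ι → ℤ_[p]) (g : MvPolynomial ι ℤ) :
    ((MvPolynomial.aeval w g : ℤ_[p]) : ℚ_[p]) =
      MvPolynomial.aeval (fun i => (w i : ℚ_[p])) g := by
  have := MvPolynomial.map_aeval w (PadicInt.Coe.ringHom (p := p)) g
  rw [MvPolynomial.aeval_def, MvPolynomial.coe_eval₂Hom] at this
  rw [MvPolynomial.aeval_def, MvPolynomial.aeval_def]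
  refine this.trans ?_
  congr 1

theorem exists_padicInt_coe {ι : Type*} {z : ι → ℚ_[p]} (hz : ∀ i, ‖z i‖ ≤ 1) :
    ∃ w : ι → ℤ_[p], z = fun i => (w i : ℚ_[p]) :=
  ⟨fun i => ⟨z i, hz i⟩, rfl⟩

theorem norm_aeval_le_one {ι : Type*} {z : ι → ℚ_[p]} (hz : ∀ i, ‖z i‖ ≤ 1)
    (g : MvPolynomial ι ℤ) : ‖MvPolynomial.aeval z g‖ ≤ 1 := by
  obtain ⟨w, rfl⟩ := exists_padicInt_coe hz
  rw [← padicInt_coe_aeval]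
  exact PadicInt.norm_le_one _

theorem norm_aeval_le_of_pow_dvd {ι : Type*} {z : ι → ℚ_[p]} (hz : ∀ i, ‖z i‖ ≤ 1)
    {g : MvPolynomial ι ℤ} {s : ℕ} (hg : ((p ^ s : ℕ) : MvPolynomial ι ℤ) ∣ g) :
    ‖MvPolynomial.aeval z g‖ ≤ ((p : ℝ)⁻¹) ^ s := by
  obtain ⟨h, rfl⟩ := hg
  rw [map_mul, map_natCast, Nat.cast_pow, norm_mul, norm_pow, Padic.norm_p]
  exact mul_le_of_le_one_right (by positivity) (norm_aeval_le_one hz h)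

theorem norm_eq_one_of_norm_sub_lt {E : Type*} [NormedAddCommGroup E] [IsUltrametricDist E]
    {x y : E} (hy : ‖y‖ = 1) (h : ‖x - y‖ < 1) : ‖x‖ = 1 := by
  have := IsUltrametricDist.norm_add_eq_max_of_norm_ne_norm (x := x - y) (y := y)
    (by rw [hy]; exact h.ne)
  rw [sub_add_cancel, hy, max_eq_right h.le] at this
  exact this

theorem inv_prime_lt_one : (p : ℝ)⁻¹ < 1 :=
  inv_lt_one_of_one_lt₀ (by exact_mod_cast (Fact.out : p.Prime).one_lt)

theorem norm_aeval_lt_one_of_dvd {ι : Type*} {z : ι → ℚ_[p]} (hz : ∀ i, ‖z i‖ ≤ 1)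
    {g : MvPolynomial ι ℤ} (hg : (p : MvPolynomial ι ℤ) ∣ g) :
    ‖MvPolynomial.aeval z g‖ < 1 := by
  refine (norm_aeval_le_of_pow_dvd hz (s := 1) (by rwa [pow_one])).trans_lt ?_
  rw [pow_one]
  exact inv_prime_lt_one

/-- `T̄_1(z^p) ≡ T̄_1(z)^p` modulo `p`, and the right side is a unit. -/
theorem pow_mem_domainD {z : Fin 3 → ℚ_[p]} (hz : z ∈ domainD p) :
    (fun i => z i ^ p) ∈ domainD p := by
  refine ⟨fun i => ?_, ?_⟩
  · rw [norm_pow]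
    exact pow_le_one₀ (norm_nonneg _) (hz.1 i)
  · rw [evalTBar, ← aeval_frobZ]
    have h := norm_aeval_lt_one_of_dvd hz.1 (MvPolynomial.dvd_pow_sub_expand p (approxPolyBar p 1))
    rw [map_sub, map_pow, norm_sub_rev] at h
    refine norm_eq_one_of_norm_sub_lt ?_ h
    rw [norm_pow]
    exact (congrArg (· ^ p) hz.2).trans (one_pow p)

theorem norm_evalTBar_eq_one (hp : p ≠ 2) (s : ℕ) {z : Fin 3 → ℚ_[p]} (hz : z ∈ domainD p) :
    ‖evalTBar p s z‖ = 1 := by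
  have hodd := (Fact.out : p.Prime).odd_of_ne_two hp
  induction s generalizing z with
  | zero => simp [evalTBar, approxPolyBar_zero]
  | succ s ih =>
    have h := norm_aeval_lt_one_of_dvd hz.1 (dvd_approxPolyBar_succ_sub p hodd s)
    rw [map_sub, map_mul, aeval_frobZ] at h
    refine norm_eq_one_of_norm_sub_lt ?_ h
    rw [norm_mul]
    have h1 := hz.2
    have h2 := ih (pow_mem_domainD hz)
    rw [evalTBar] at h1 h2
    rw [h1, h2, one_mul]

theorem norm_ratioT_eq_one (hp : p ≠ 2) (s : ℕ) {z : Fin 3 → ℚ_[p]} (hz : z ∈ domainD p) :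
    ‖ratioT p s z‖ = 1 := by
  rw [ratioT, norm_div, norm_evalTBar_eq_one hp _ hz,
    norm_evalTBar_eq_one hp _ (pow_mem_domainD hz), div_one]

theorem norm_ratioT_succ_sub_le (hp : p ≠ 2) (s : ℕ) {z : Fin 3 → ℚ_[p]} (hz : z ∈ domainD p) :
    ‖ratioT p (s + 1) z - ratioT p s z‖ ≤ ((p : ℝ)⁻¹) ^ s := by
  have hodd := (Fact.out : p.Prime).odd_of_ne_two hp
  have h := norm_aeval_le_of_pow_dvd hz.1 (pow_dvd_approxPolyBar p hodd (Nat.le_add_left 1 s))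
  rw [map_sub, map_mul, map_mul, aeval_frobZ, aeval_frobZ, Nat.add_sub_cancel] at h
  have h1 := norm_evalTBar_eq_one hp s (pow_mem_domainD hz)
  have h2 := norm_evalTBar_eq_one hp (s + 1) (pow_mem_domainD hz)
  have h1' : evalTBar p s (fun i => z i ^ p) ≠ 0 := norm_ne_zero_iff.mp (by rw [h1]; simp)
  have h2' : evalTBar p (s + 1) (fun i => z i ^ p) ≠ 0 := norm_ne_zero_iff.mp (by rw [h2]; simp)
  rw [ratioT, ratioT, div_sub_div _ _ h2' h1', norm_div, norm_mul, h1, h2, one_mul, div_one,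
    mul_comm (evalTBar p (s + 1) _) (evalTBar p (s + 1) z)]
  refine h.trans ?_
  exact pow_le_pow_of_le_one (by positivity) inv_prime_lt_one.le (Nat.le_succ s)

/-- Membership in 𝔇 depends only on residues: points congruent modulo `p` have congruent values of
`T̄_1`. -/
theorem mem_domainD_of_norm_sub_lt {a z : Fin 3 → ℚ_[p]} (ha : a ∈ domainD p)
    (h : ∀ i, ‖z i - a i‖ < 1) : z ∈ domainD p := by
  have hz : ∀ i, ‖z i‖ ≤ 1 := fun i => by
    rw [← sub_add_cancel (z i) (a i)]
    exact (IsUltrametricDist.norm_add_le_max _ _).trans (max_le (h i).le (ha.1 i))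
  refine ⟨hz, norm_eq_one_of_norm_sub_lt ha.2 ?_⟩
  obtain ⟨w, rfl⟩ := exists_padicInt_coe hz
  obtain ⟨b, rfl⟩ := exists_padicInt_coe ha.1
  rw [evalTBar, evalTBar, ← padicInt_coe_aeval, ← padicInt_coe_aeval, ← PadicInt.coe_sub]
  change ‖(_ : ℤ_[p])‖ < 1
  rw [PadicInt.norm_lt_one_iff_dvd, ← Ideal.mem_span_singleton, ← Ideal.Quotient.mk_eq_mk_iff_sub_mem]
  set π := Ideal.Quotient.mk (Ideal.span {(p : ℤ_[p])})
  have hπ : ∀ v : Fin 3 → ℤ_[p], π (MvPolynomial.aeval v (approxPolyBar p 1)) =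
      MvPolynomial.eval₂ (Int.castRingHom _) (fun i => π (v i)) (approxPolyBar p 1) := fun v => by
    rw [MvPolynomial.map_aeval, MvPolynomial.coe_eval₂Hom]
    congr 1
  rw [hπ, hπ]
  congr 1
  funext i
  rw [Ideal.Quotient.mk_eq_mk_iff_sub_mem, Ideal.mem_span_singleton,
    ← PadicInt.norm_lt_one_iff_dvd]
  exact h i

end Evaluation

/-! ### Power series over `ℤ_p` and analyticity of the limit -/

section PowerSeries

variable {p : ℕ} [Fact p.Prime]

/-- Needed for `MvPowerSeries.aeval`, which substitutes topologically nilpotent elements. -/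
instance PadicInt.isLinearTopology : IsLinearTopology ℤ_[p] ℤ_[p] := by
  refine IsLinearTopology.mk_of_hasBasis ℤ_[p] (ι := ℕ) (p := fun _ => True)
    (s := fun n => (Ideal.span {(p : ℤ_[p]) ^ n} : Ideal ℤ_[p])) ?_
  refine (Metric.nhds_basis_closedBall_pow (r := (p : ℝ)⁻¹) ?_ inv_prime_lt_one).congr
    (fun _ => Iff.rfl) fun n _ => ?_
  · exact inv_pos.mpr (by exact_mod_cast (Fact.out : p.Prime).pos)
  · ext x
    rw [SetLike.mem_coe, ← PadicInt.norm_le_pow_iff_mem_span_pow, mem_closedBall_zero_iff,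
      zpow_neg, zpow_natCast, inv_pow]

theorem PadicInt.hasEval {d : ℕ} {y : Fin d → ℤ_[p]} (hy : ∀ i, ‖y i‖ < 1) :
    MvPowerSeries.HasEval y where
  hpow i := tendsto_pow_atTop_nhds_zero_of_norm_lt_one (hy i)
  tendsto_zero := by simp [cofinite_eq_bot]

/-- The `k`-linear form `(v₁, …, v_k) ↦ ∏ vⱼ(lⱼ)` attached to a list `l` of indices. -/
noncomputable def coordProd {d : ℕ} (l : List (Fin d)) (k : ℕ) (i₀ : Fin d) :
    ContinuousMultilinearMap ℚ_[p] (fun _ : Fin k => Fin d → ℚ_[p]) ℚ_[p] :=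
  (ContinuousMultilinearMap.mkPiAlgebra ℚ_[p] (Fin k) ℚ_[p]).compContinuousLinearMap
    fun j => ContinuousLinearMap.proj (l.getD j i₀)

theorem norm_coordProd_apply_le {d : ℕ} (l : List (Fin d)) (k : ℕ) (i₀ : Fin d)
    (v : Fin k → Fin d → ℚ_[p]) : ‖coordProd l k i₀ v‖ ≤ ∏ j, ‖v j‖ := by
  simp only [coordProd, ContinuousMultilinearMap.compContinuousLinearMap_apply,
    ContinuousMultilinearMap.mkPiAlgebra_apply, ContinuousLinearMap.proj_apply, norm_prod]
  exact prod_le_prod (fun _ _ => norm_nonneg _) fun j _ => norm_le_pi_norm _ _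

/-- On the diagonal the order of the list is immaterial, and its length is the degree, so the
default index `i₀` is never used. -/
theorem coordProd_apply_const {d : ℕ} (e : Fin d →₀ ℕ) (i₀ : Fin d) (y : Fin d → ℚ_[p]) :
    coordProd e.toMultiset.toList e.degree i₀ (fun _ => y) = e.prod fun i k => y i ^ k := by
  have hl : e.toMultiset.toList.length = e.degree := by
    rw [Multiset.length_toList, Finsupp.card_toMultiset, Finsupp.degree_eq_sum, Finsupp.sum_fintype]
    · rfl
    · intro _; rfl
  simp only [coordProd, ContinuousMultilinearMap.compContinuousLinearMap_apply,
    ContinuousMultilinearMap.mkPiAlgebra_apply, ContinuousLinearMap.proj_apply]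
  rw [← hl]
  have h1 : ∀ j : Fin e.toMultiset.toList.length,
      y (e.toMultiset.toList.getD j i₀) = y (e.toMultiset.toList.get j) := fun j => by
    rw [List.getD_eq_getElem _ _ j.2, List.get_eq_getElem]
  simp_rw [h1]
  have h2 := List.prod_ofFn (f := fun j => y (e.toMultiset.toList.get j))
  rw [← h2, List.ofFn_comp' e.toMultiset.toList.get y, List.ofFn_get, ← Multiset.prod_coe,
    ← Multiset.map_coe, Multiset.coe_toList, Finsupp.toMultiset_map, Finsupp.prod_toMultiset,
    Finsupp.prod_mapDomain_index]
  · intro _; simp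
  · intros; rw [pow_add]

/-- The exponents of total degree `k`. -/
noncomputable def degreeFinset (d k : ℕ) : Finset (Fin d →₀ ℕ) := finsuppAntidiag univ k

theorem mem_degreeFinset {d k : ℕ} {e : Fin d →₀ ℕ} : e ∈ degreeFinset d k ↔ e.degree = k := by
  rw [degreeFinset, mem_finsuppAntidiag, Finsupp.degree_eq_sum]
  simp

/-- The formal multilinear series over `ℚ_p` of a power series with coefficients in `ℤ_p`. -/
noncomputable def padicFMS {d : ℕ} (i₀ : Fin d) (G : MvPowerSeries (Fin d) ℤ_[p]) :
    FormalMultilinearSeries ℚ_[p] (Fin d → ℚ_[p]) ℚ_[p] := fun k =>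
  ∑ e ∈ degreeFinset d k,
    ((MvPowerSeries.coeff e G : ℤ_[p]) : ℚ_[p]) • coordProd e.toMultiset.toList k i₀

theorem norm_padicFMS_le_one {d : ℕ} (i₀ : Fin d) (G : MvPowerSeries (Fin d) ℤ_[p]) (k : ℕ) :
    ‖padicFMS i₀ G k‖ ≤ 1 := by
  refine ContinuousMultilinearMap.opNorm_le_bound zero_le_one fun v => ?_
  rw [one_mul, padicFMS, _root_.sum_apply]
  refine IsUltrametricDist.norm_sum_le_of_forall_le_of_nonneg
    (prod_nonneg fun _ _ => norm_nonneg _) fun e _ => ?_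
  rw [_root_.smul_apply, norm_smul]
  exact (mul_le_of_le_one_left (norm_nonneg _) (PadicInt.norm_le_one _)).trans
    (norm_coordProd_apply_le _ _ _ _)

/-- Regroups the sum over exponents by total degree. -/
theorem hasSum_padicFMS {d : ℕ} (i₀ : Fin d) (G : MvPowerSeries (Fin d) ℤ_[p])
    {y : Fin d → ℤ_[p]} (hy : ∀ i, ‖y i‖ < 1) :
    HasSum (fun k => padicFMS i₀ G k fun _ => fun i => (y i : ℚ_[p]))
      ((MvPowerSeries.aeval (PadicInt.hasEval hy) G : ℤ_[p]) : ℚ_[p]) := by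
  let ψ : ℤ_[p] →+* ℚ_[p] := PadicInt.Coe.ringHom
  have hψ : ∀ x : ℤ_[p], ψ x = (x : ℚ_[p]) := fun _ => rfl
  have hψc : Continuous ψ := continuous_subtype_val
  clear_value ψ
  let t : (Fin d →₀ ℕ) → ℚ_[p] := fun e =>
    ψ (MvPowerSeries.coeff e G) * e.prod fun i n => (y i : ℚ_[p]) ^ n
  have h : HasSum t ((MvPowerSeries.aeval (PadicInt.hasEval hy) G : ℤ_[p]) : ℚ_[p]) := by
    have := (MvPowerSeries.hasSum_aeval (PadicInt.hasEval hy) G).map ψ hψc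
    rw [hψ] at this
    refine this.congr_fun fun e => ?_
    simp only [Function.comp_apply, t, smul_eq_mul, map_mul, map_finsuppProd, map_pow]
    simp only [hψ]
  have e1 : ∀ k, padicFMS i₀ G k (fun _ i => (y i : ℚ_[p])) = ∑ e ∈ degreeFinset d k, t e := by
    intro k
    rw [padicFMS, _root_.sum_apply]
    refine sum_congr rfl fun e he => ?_
    rw [← mem_degreeFinset.mp he, _root_.smul_apply, coordProd_apply_const, smul_eq_mul]
    simp only [t, hψ]
  clear_value t
  refine ((Equiv.sigmaFiberEquiv (Finsupp.degree (σ := Fin d) (R := ℕ))).hasSum_iff.mpr h).sigma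
    fun k => ?_
  rw [e1]
  have h2 : HasSum (fun e : {e : Fin d →₀ ℕ // e.degree = k} => t e)
      (∑ e ∈ degreeFinset d k, t e) :=
    (Equiv.subtypeEquivRight fun e => mem_degreeFinset.symm).hasSum_iff.mpr
      ((degreeFinset d k).hasSum t)
  exact h2

theorem hasFPowerSeriesOnBall_padicFMS {d : ℕ} (i₀ : Fin d) (G : MvPowerSeries (Fin d) ℤ_[p])
    {f : (Fin d → ℚ_[p]) → ℚ_[p]} {a : Fin d → ℚ_[p]}
    (hf : ∀ (y : Fin d → ℤ_[p]) (hy : ∀ i, ‖y i‖ < 1), f (fun i => a i + y i) =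
      ((MvPowerSeries.aeval (PadicInt.hasEval hy) G : ℤ_[p]) : ℚ_[p])) :
    HasFPowerSeriesOnBall f (padicFMS i₀ G) a 1 where
  r_le := by
    have := (padicFMS i₀ G).le_radius_of_bound 1 (r := 1) fun n => by
      simpa using norm_padicFMS_le_one i₀ G n
    simpa using this
  r_pos := one_pos
  hasSum := by
    intro y hy
    have hy1 : ‖y‖ < 1 := by simpa [← ofReal_norm] using hy
    have hyi : ∀ i, ‖y i‖ < 1 := fun i => (norm_le_pi_norm y i).trans_lt hy1
    have := hasSum_padicFMS i₀ G (y := fun i => ⟨y i, (hyi i).le⟩) hyi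
    exact (hf (fun i => ⟨y i, (hyi i).le⟩) hyi) ▸ this

/-- Expansion of an integral polynomial around a point of `ℤ_p ^ d`. -/
noncomputable def expandAt {d : ℕ} (a : Fin d → ℤ_[p]) :
    MvPolynomial (Fin d) ℤ →+* MvPowerSeries (Fin d) ℤ_[p] :=
  MvPolynomial.eval₂Hom (Int.castRingHom _) fun i => MvPowerSeries.C (a i) + MvPowerSeries.X i

theorem aeval_expandAt {d : ℕ} (a : Fin d → ℤ_[p]) {y : Fin d → ℤ_[p]} (hy : ∀ i, ‖y i‖ < 1)
    (g : MvPolynomial (Fin d) ℤ) :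
    MvPowerSeries.aeval (PadicInt.hasEval hy) (expandAt a g) =
      MvPolynomial.aeval (fun i => a i + y i) g := by
  have h : ((MvPowerSeries.aeval (PadicInt.hasEval hy)).toRingHom.comp (expandAt a)) =
      (MvPolynomial.aeval (R := ℤ) (fun i => a i + y i)).toRingHom := by
    refine MvPolynomial.ringHom_ext (fun r => by simp) fun i => ?_
    have h1 : (MvPowerSeries.C (a i) : MvPowerSeries (Fin d) ℤ_[p]) =
      ((MvPolynomial.C (a i) : MvPolynomial (Fin d) ℤ_[p]) : MvPowerSeries (Fin d) ℤ_[p]) := by simp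
    have h2 : (MvPowerSeries.X i : MvPowerSeries (Fin d) ℤ_[p]) =
      ((MvPolynomial.X i : MvPolynomial (Fin d) ℤ_[p]) : MvPowerSeries (Fin d) ℤ_[p]) := by simp
    simp [expandAt, h1, h2, MvPowerSeries.aeval_coe, -MvPolynomial.coe_C, -MvPolynomial.coe_X]
  exact congrArg (fun φ : _ →+* _ => φ g) h

theorem constantCoeff_expandAt {d : ℕ} (a : Fin d → ℤ_[p]) (g : MvPolynomial (Fin d) ℤ) :
    MvPowerSeries.constantCoeff (expandAt a g) = MvPolynomial.aeval a g := by
  have h : ((MvPowerSeries.constantCoeff (σ := Fin d) (R := ℤ_[p])).comp (expandAt a)) =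
      (MvPolynomial.aeval (R := ℤ) a).toRingHom := by
    refine MvPolynomial.ringHom_ext (fun r => by simp) fun i => ?_
    simp [expandAt]
  exact congrArg (fun φ : _ →+* _ => φ g) h

/-- `p`-adically convergent sequences of power series have a limit. -/
theorem exists_powerSeries_limit {d : ℕ} {u : ℕ → MvPowerSeries (Fin d) ℤ_[p]}
    (hu : ∀ s, ((p ^ s : ℕ) : MvPowerSeries (Fin d) ℤ_[p]) ∣ u (s + 1) - u s) :
    ∃ G, ∀ s, ((p ^ s : ℕ) : MvPowerSeries (Fin d) ℤ_[p]) ∣ G - u s := by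
  have key : ∀ (x : ℤ_[p]) s, ‖x‖ ≤ ((p : ℝ)⁻¹) ^ s ↔ ((p ^ s : ℕ) : ℤ_[p]) ∣ x := fun x s => by
    rw [Nat.cast_pow, ← Ideal.mem_span_singleton, ← PadicInt.norm_le_pow_iff_mem_span_pow,
      zpow_neg, zpow_natCast, inv_pow]
  have hc : ∀ (c : ℕ) (g : MvPowerSeries (Fin d) ℤ_[p]) e, MvPowerSeries.coeff e ((c : MvPowerSeries (Fin d) ℤ_[p]) * g) =
      (c : ℤ_[p]) * MvPowerSeries.coeff e g := fun c g e => by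
    rw [← nsmul_eq_mul, map_nsmul, nsmul_eq_mul]
  have h1 : ∀ e : Fin d →₀ ℕ, ∃ L : ℤ_[p], ∀ s, ‖L - MvPowerSeries.coeff e (u s)‖ ≤
      ((p : ℝ)⁻¹) ^ s := fun e => by
    refine exists_norm_sub_le_of_ultrametric (by positivity) (inv_prime_lt_one (p := p))
      fun s => ?_
    obtain ⟨g, hg⟩ := hu s
    rw [key, ← map_sub, hg, hc]
    exact dvd_mul_right _ _
  choose L hL using h1
  have hmk : ∀ v : (Fin d →₀ ℕ) → ℤ_[p], ∃ G : MvPowerSeries (Fin d) ℤ_[p],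
      ∀ e, MvPowerSeries.coeff e G = v e := fun v => ⟨fun e => v e, fun _ => rfl⟩
  obtain ⟨G, hG⟩ := hmk L
  refine ⟨G, fun s => ?_⟩
  choose c hcc using fun e => (key _ _).mp (hL e s)
  obtain ⟨g, hg⟩ := hmk c
  refine ⟨g, ?_⟩
  ext1 e
  rw [hc, map_sub, hG, hg]
  exact hcc e

/-- The expansion of each denominator at `a` has a unit constant term, so every ratio is a power
series over `ℤ_p`; the Dwork congruence makes these converge p-adically to `G`. -/
theorem exists_powerSeries_of_ratioT (hp : p ≠ 2) {a : Fin 3 → ℤ_[p]}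
    (ha : (fun i => (a i : ℚ_[p])) ∈ domainD p) :
    ∃ G : MvPowerSeries (Fin 3) ℤ_[p], ∀ (y : Fin 3 → ℤ_[p]) (hy : ∀ i, ‖y i‖ < 1) (s : ℕ),
      ‖((MvPowerSeries.aeval (PadicInt.hasEval hy) G : ℤ_[p]) : ℚ_[p]) -
        ratioT p s (fun i => a i + y i)‖ ≤ ((p : ℝ)⁻¹) ^ s := by
  have hodd := (Fact.out : p.Prime).odd_of_ne_two hp
  have hunit : ∀ s, IsUnit (expandAt a (frobZ p (approxPolyBar p s))) := fun s => by
    rw [MvPowerSeries.isUnit_iff_constantCoeff, constantCoeff_expandAt, PadicInt.isUnit_iff,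
      PadicInt.norm_def, padicInt_coe_aeval, aeval_frobZ]
    exact norm_evalTBar_eq_one hp s (pow_mem_domainD ha)
  choose E hE using fun s => (hunit s).exists_right_inv
  obtain ⟨G, hG⟩ := exists_powerSeries_limit (p := p)
    (u := fun s => expandAt a (approxPolyBar p (s + 1)) * E s) fun s => by
      have h := map_dvd (expandAt a) (pow_dvd_approxPolyBar p hodd (Nat.le_add_left 1 s))
      rw [map_natCast, map_sub, map_mul, map_mul, Nat.add_sub_cancel] at h
      have h2 := (Nat.cast_dvd_cast (pow_dvd_pow p (Nat.le_succ s))).trans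
        (h.mul_right (E s * E (s + 1)))
      convert h2 using 1
      -- Difference of two fractions, with `E s` and `E (s + 1)` as inverse denominators.
      linear_combination expandAt a (approxPolyBar p (s + 1)) * E s * hE (s + 1) -
        expandAt a (approxPolyBar p (s + 1 + 1)) * E (s + 1) * hE s
  refine ⟨G, fun y hy s => ?_⟩
  obtain ⟨g, hg⟩ := hG s
  have hz : (fun i => (a i : ℚ_[p]) + y i) ∈ domainD p :=
    mem_domainD_of_norm_sub_lt ha fun i => by rw [add_sub_cancel_left]; exact hy i
  have h1 : ratioT p s (fun i => (a i : ℚ_[p]) + y i) = ((MvPowerSeries.aeval (PadicInt.hasEval hy)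
      (expandAt a (approxPolyBar p (s + 1)) * E s) : ℤ_[p]) : ℚ_[p]) := by
    have hne : evalTBar p s (fun i => ((a i : ℚ_[p]) + y i) ^ p) ≠ 0 := by
      rw [← norm_ne_zero_iff, norm_evalTBar_eq_one hp s (pow_mem_domainD hz)]
      exact one_ne_zero
    rw [ratioT, div_eq_iff hne, evalTBar, evalTBar, ← aeval_frobZ]
    have e : ∀ g : MvPolynomial (Fin 3) ℤ,
        MvPolynomial.aeval (fun i => (a i : ℚ_[p]) + y i) g =
        ((MvPowerSeries.aeval (PadicInt.hasEval hy) (expandAt a g) : ℤ_[p]) : ℚ_[p]) := fun g => by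
      rw [aeval_expandAt a hy, padicInt_coe_aeval]
      simp
    rw [e, e, ← PadicInt.coe_mul, ← map_mul, mul_assoc,
      mul_comm (E s), hE, mul_one]
  rw [h1, ← PadicInt.coe_sub, ← map_sub, hg, map_mul, map_natCast]
  rw [PadicInt.coe_mul, PadicInt.coe_natCast, Nat.cast_pow, norm_mul, norm_pow, Padic.norm_p]
  exact mul_le_of_le_one_right (by positivity) (PadicInt.norm_le_one _)

end PowerSeries

/-! ### Specialisation to `(1, x, 0)` and the hypergeometric series -/

section Hypergeometric

variable {p : ℕ} [Fact p.Prime]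

theorem evalTBar_eq_coeff (s : ℕ) (z : Fin 3 → ℚ_[p]) :
    evalTBar p s z = ((-∏ i : Fin 3, (Polynomial.X - Polynomial.C (z i))) ^
      ((p ^ s - 1) / 2)).coeff (p ^ s - 1) := by
  have h : Polynomial.map (MvPolynomial.aeval (R := ℤ) z).toRingHom (signedMaster p s) =
      (-∏ i : Fin 3, (Polynomial.X - Polynomial.C (z i))) ^ ((p ^ s - 1) / 2) := by
    simp [signedMaster, Polynomial.map_prod, Polynomial.map_pow]
  rw [evalTBar, ← coeff_signedMaster, ← h, Polynomial.coeff_map]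
  rfl

theorem coeff_one_sub_mul_pow {K : Type*} [CommRing K] (x : K) (m : ℕ) :
    (((1 - Polynomial.X) * (Polynomial.X - Polynomial.C x)) ^ m).coeff m =
      ∑ k ∈ range (m + 1), (m.choose k : K) ^ 2 * x ^ k := by
  have h1 : (1 - Polynomial.X) * (Polynomial.X - Polynomial.C x) =
      (Polynomial.X + Polynomial.C (-1)) * (Polynomial.X + Polynomial.C (-x)) *
        Polynomial.C (-1) := by
    simp only [Polynomial.C_neg, Polynomial.C_1]
    ring
  rw [h1, mul_pow, mul_pow, ← Polynomial.C_pow, Polynomial.coeff_mul_C, Polynomial.coeff_mul,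
    Finset.Nat.sum_antidiagonal_eq_sum_range_succ_mk, sum_mul]
  refine sum_congr rfl fun k hk => ?_
  have hk : k ≤ m := Nat.lt_succ_iff.mp (mem_range.mp hk)
  rw [Polynomial.coeff_X_add_C_pow, Polynomial.coeff_X_add_C_pow, Nat.choose_symm hk,
    Nat.sub_sub_self hk, neg_pow x]
  obtain ⟨j, rfl⟩ := Nat.exists_eq_add_of_le hk
  rw [Nat.add_sub_cancel_left, pow_add]
  have e : ∀ n : ℕ, ((-1 : K) ^ n) * (-1) ^ n = 1 := fun n => by
    rw [← mul_pow]; simp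
  linear_combination (((k + j).choose k : K) ^ 2 * x ^ k) * (e k * ((-1) ^ j * (-1) ^ j) + e j)

theorem two_mul_half_pow_sub_one (hp : p ≠ 2) (s : ℕ) : p ^ s - 1 = 2 * ((p ^ s - 1) / 2) := by
  obtain ⟨u, hu⟩ := ((Fact.out : p.Prime).odd_of_ne_two hp).pow (n := s)
  omega

theorem evalTBar_one_zero (hp : p ≠ 2) (s : ℕ) (x : ℚ_[p]) :
    evalTBar p s ![1, x, 0] = ∑ k ∈ range ((p ^ s - 1) / 2 + 1),
      (((p ^ s - 1) / 2).choose k : ℚ_[p]) ^ 2 * x ^ k := by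
  rw [evalTBar_eq_coeff, ← coeff_one_sub_mul_pow]
  have h : (-∏ i : Fin 3, (Polynomial.X - Polynomial.C ((![1, x, 0] : Fin 3 → ℚ_[p]) i))) =
      ((1 - Polynomial.X) * (Polynomial.X - Polynomial.C x)) * Polynomial.X := by
    simp [Fin.prod_univ_three]
    ring
  have h2 : p ^ s - 1 = (p ^ s - 1) / 2 + (p ^ s - 1) / 2 := by
    rw [← two_mul, ← two_mul_half_pow_sub_one hp s]
  rw [h, mul_pow]
  generalize (p ^ s - 1) / 2 = m at h2
  -- The root `z₃ = 0` contributes `X ^ m`, lowering the coefficient index from `2 * m` to `m`.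
  rw [h2, Polynomial.coeff_mul_X_pow]

theorem evalTBar_one_zero_tsum (hp : p ≠ 2) (s : ℕ) (x : ℚ_[p]) :
    evalTBar p s ![1, x, 0] =
      ∑' k, (((p ^ s - 1) / 2).choose k : ℚ_[p]) ^ 2 * x ^ k := by
  rw [evalTBar_one_zero hp, tsum_eq_sum]
  intro k hk
  rw [Nat.choose_eq_zero_of_lt (by simpa using hk)]
  simp

theorem choose_sq_eq_hypergeometricCoefficient (m k : ℕ) :
    (m.choose k : ℚ_[p]) ^ 2 = ordinaryHypergeometricCoefficient (-m : ℚ_[p]) (-m) 1 k := by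
  have hk : (k.factorial : ℚ_[p]) ≠ 0 := by exact_mod_cast k.factorial_ne_zero
  have hs : ((-1 : ℚ_[p]) ^ k) * (-1) ^ k = 1 := by rw [← mul_pow]; simp
  rw [ordinaryHypergeometricCoefficient, ascPochhammer_eval_one,
    ascPochhammer_eval_neg_eq_descPochhammer, descPochhammer_eval_eq_descFactorial,
    Nat.descFactorial_eq_factorial_mul_choose, Nat.cast_mul]
  field_simp
  linear_combination -((m.choose k : ℚ_[p]) ^ 2) * hs

theorem tendsto_neg_half_pow_sub_one (hp : p ≠ 2) :
    Tendsto (fun s : ℕ => -(((p ^ s - 1) / 2 : ℕ) : ℚ_[p])) atTop (𝓝 (1 / 2)) := by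
  have h1 : ∀ s : ℕ, -(((p ^ s - 1) / 2 : ℕ) : ℚ_[p]) = (1 - (p : ℚ_[p]) ^ s) / 2 := fun s => by
    have h := congrArg (Nat.cast (R := ℚ_[p])) (two_mul_half_pow_sub_one hp s)
    rw [Nat.cast_sub (Nat.one_le_pow _ _ (Fact.out : p.Prime).pos), Nat.cast_mul] at h
    push_cast at h ⊢
    linear_combination (1 / 2 : ℚ_[p]) * h
  simp_rw [h1]
  have h2 : Tendsto (fun s : ℕ => (p : ℚ_[p]) ^ s) atTop (𝓝 0) :=
    tendsto_pow_atTop_nhds_zero_of_norm_lt_one Padic.norm_p_lt_one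
  simpa using (h2.const_sub 1).div_const 2

theorem tendsto_choose_sq (hp : p ≠ 2) (k : ℕ) :
    Tendsto (fun s : ℕ => (((p ^ s - 1) / 2).choose k : ℚ_[p]) ^ 2) atTop
      (𝓝 (ordinaryHypergeometricCoefficient (1 / 2 : ℚ_[p]) (1 / 2) 1 k)) := by
  simp_rw [choose_sq_eq_hypergeometricCoefficient]
  have h := ((ascPochhammer ℚ_[p] k).continuous.tendsto (1 / 2)).comp
    (tendsto_neg_half_pow_sub_one hp)
  exact ((h.const_mul _).mul h).mul_const _

theorem norm_natCast_sq_le_one (n : ℕ) : ‖(n : ℚ_[p]) ^ 2‖ ≤ 1 := by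
  rw [norm_pow]
  exact pow_le_one₀ (norm_nonneg _) (by exact_mod_cast Padic.norm_int_le_one (n : ℤ))

/-- The coefficients are p-adic limits of squares of integers. The resulting geometric bound yields
summability. -/
theorem norm_hypergeometricCoefficient_half_le (hp : p ≠ 2) (k : ℕ) :
    ‖ordinaryHypergeometricCoefficient (1 / 2 : ℚ_[p]) (1 / 2) 1 k‖ ≤ 1 :=
  le_of_tendsto' (tendsto_choose_sq hp k).norm fun _ => norm_natCast_sq_le_one _

theorem summable_hypergeometricSeries_half (hp : p ≠ 2) {x : ℚ_[p]} (hx : ‖x‖ < 1) :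
    Summable (fun k : ℕ =>
      ordinaryHypergeometricSeries ℚ_[p] (1 / 2 : ℚ_[p]) (1 / 2) 1 k (fun _ => x)) := by
  refine Summable.of_norm_bounded (summable_geometric_of_lt_one (norm_nonneg x) hx) fun k => ?_
  rw [ordinaryHypergeometricSeries_apply_eq, norm_smul, norm_pow]
  exact mul_le_of_le_one_left (by positivity) (norm_hypergeometricCoefficient_half_le hp k)

theorem tendsto_evalTBar_hypF (hp : p ≠ 2) {x : ℚ_[p]} (hx : ‖x‖ < 1) :
    Tendsto (fun s => evalTBar p s ![1, x, 0]) atTop (𝓝 (hypF p x)) := by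
  simp_rw [evalTBar_one_zero_tsum hp]
  rw [hypF, ordinaryHypergeometric, ordinaryHypergeometric_sum_eq]
  refine tendsto_tsum_of_dominated_convergence
    (summable_geometric_of_lt_one (norm_nonneg x) hx) (fun k => ?_) (Eventually.of_forall fun s k => ?_)
  · exact (tendsto_choose_sq hp k).mul_const _
  · rw [norm_mul, norm_pow x]
    exact mul_le_of_le_one_left (by positivity) (norm_natCast_sq_le_one _)

/-- `T̄_1(1, 0, 0) = 1`, and 𝔇 contains the open unit polydisc around each of its points. -/
theorem one_zero_mem_domainD (hp : p ≠ 2) {x : ℚ_[p]} (hx : ‖x‖ < 1) :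
    ![1, x, 0] ∈ domainD p := by
  refine mem_domainD_of_norm_sub_lt (a := ![1, 0, 0]) ⟨fun i => ?_, ?_⟩ fun i => ?_
  · fin_cases i <;> simp
  · rw [evalTBar_one_zero hp, sum_eq_single 0] <;> simp +contextual
  · fin_cases i <;> simp [hx]

theorem one_zero_pow (x : ℚ_[p]) :
    (fun i => (![1, x, 0] : Fin 3 → ℚ_[p]) i ^ p) = ![1, x ^ p, 0] := by
  funext i
  fin_cases i <;> simp [(Fact.out : p.Prime).ne_zero]

theorem norm_hypF_eq_one (hp : p ≠ 2) {x : ℚ_[p]} (hx : ‖x‖ < 1) : ‖hypF p x‖ = 1 := by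
  refine tendsto_nhds_unique (tendsto_evalTBar_hypF hp hx).norm ?_
  simp_rw [norm_evalTBar_eq_one hp _ (one_zero_mem_domainD hp hx)]
  exact tendsto_const_nhds

theorem norm_pow_prime_lt_one {x : ℚ_[p]} (hx : ‖x‖ < 1) : ‖x ^ p‖ < 1 := by
  rw [norm_pow]
  exact pow_lt_one₀ (norm_nonneg _) hx (Fact.out : p.Prime).ne_zero

theorem hypF_pow_ne_zero (hp : p ≠ 2) {x : ℚ_[p]} (hx : ‖x‖ < 1) : hypF p (x ^ p) ≠ 0 := by
  rw [← norm_ne_zero_iff, norm_hypF_eq_one hp (norm_pow_prime_lt_one hx)]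
  exact one_ne_zero

theorem tendsto_ratioT_one_zero (hp : p ≠ 2) {x : ℚ_[p]} (hx : ‖x‖ < 1) :
    Tendsto (fun s => ratioT p s ![1, x, 0]) atTop (𝓝 (hypF p x / hypF p (x ^ p))) := by
  simp_rw [ratioT, one_zero_pow]
  exact ((tendsto_add_atTop_iff_nat 1).mpr (tendsto_evalTBar_hypF hp hx)).div
    (tendsto_evalTBar_hypF hp (norm_pow_prime_lt_one hx)) (hypF_pow_ne_zero hp hx)

end Hypergeometric

/-! ### The limit function and its properties -/

theorem tendsto_inv_prime_pow {p : ℕ} [Fact p.Prime] :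
    Tendsto (fun s : ℕ => ((p : ℝ)⁻¹) ^ s) atTop (𝓝 0) :=
  tendsto_pow_atTop_nhds_zero_of_lt_one (by positivity) inv_prime_lt_one

theorem tendsto_of_norm_sub_le_inv_prime_pow {p : ℕ} [Fact p.Prime] {E : Type*}
    [NormedAddCommGroup E] {u : ℕ → E} {L : E} (h : ∀ s, ‖L - u s‖ ≤ ((p : ℝ)⁻¹) ^ s) :
    Tendsto u atTop (𝓝 L) := by
  rw [tendsto_iff_norm_sub_tendsto_zero]
  refine squeeze_zero (fun _ => norm_nonneg _) (fun s => ?_) (tendsto_inv_prime_pow (p := p))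
  rw [norm_sub_rev]
  exact h s

theorem mainTheorem9 (p : ℕ) [Fact p.Prime] (hp : p ≠ 2) :
    -- regularity on `𝔇`: the denominators do not vanish there
    (∀ s : ℕ, 1 ≤ s → ∀ z ∈ domainD p, evalTBar p s (fun i => z i ^ p) ≠ 0) ∧
    ∃ f : (Fin 3 → ℚ_[p]) → ℚ_[p],
      -- uniform convergence on `𝔇`
      TendstoUniformlyOn (fun s z => ratioT p s z) f Filter.atTop (domainD p) ∧
      -- analyticity: on the open unit polydisc around every point of `𝔇`, the limit is
      -- the sum of a convergent power series
      (∀ a ∈ domainD p, ∃ P : FormalMultilinearSeries ℚ_[p] (Fin 3 → ℚ_[p]) ℚ_[p],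
        HasFPowerSeriesOnBall f P a 1) ∧
      -- the values have norm one
      (∀ z ∈ domainD p, ‖f z‖ = 1) ∧
      -- the restriction to the points `(1, x, 0)` with `|x|_p < 1`
      (∀ x : ℚ_[p], ‖x‖ < 1 →
        ![1, x, 0] ∈ domainD p ∧
        Summable (fun k : ℕ =>
          ordinaryHypergeometricSeries ℚ_[p] (1 / 2 : ℚ_[p]) (1 / 2) 1 k (fun _ => x)) ∧
        hypF p (x ^ p) ≠ 0 ∧
        f ![1, x, 0] = hypF p x / hypF p (x ^ p)) := by
  refine ⟨fun s _ z hz => ?_, ?_⟩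
  · rw [← norm_ne_zero_iff, norm_evalTBar_eq_one hp s (pow_mem_domainD hz)]
    exact one_ne_zero
  have hlim : ∀ z : Fin 3 → ℚ_[p], ∃ L : ℚ_[p],
      z ∈ domainD p → ∀ s, ‖L - ratioT p s z‖ ≤ ((p : ℝ)⁻¹) ^ s := fun z => by
    by_cases hz : z ∈ domainD p
    · obtain ⟨L, hL⟩ := exists_norm_sub_le_of_ultrametric (by positivity)
        (inv_prime_lt_one (p := p)) (fun s => norm_ratioT_succ_sub_le hp s hz)
      exact ⟨L, fun _ => hL⟩
    -- Off 𝔇 the value is arbitrary; no claim concerns it.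
    · exact ⟨0, fun h => absurd h hz⟩
  choose f hf using hlim
  refine ⟨f, ?_, ?_, fun z hz => ?_, fun x hx => ⟨one_zero_mem_domainD hp hx,
    summable_hypergeometricSeries_half hp hx, hypF_pow_ne_zero hp hx, ?_⟩⟩
  · rw [Metric.tendstoUniformlyOn_iff]
    intro ε hε
    filter_upwards [(tendsto_inv_prime_pow (p := p)).eventually_lt_const hε] with s hs z hz
    rw [dist_eq_norm]
    exact (hf z hz s).trans_lt hs
  · intro a ha
    obtain ⟨b, rfl⟩ := exists_padicInt_coe ha.1
    obtain ⟨G, hG⟩ := exists_powerSeries_of_ratioT hp ha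
    refine ⟨padicFMS 0 G, hasFPowerSeriesOnBall_padicFMS 0 G fun y hy => ?_⟩
    have hz : (fun i => (b i : ℚ_[p]) + y i) ∈ domainD p :=
      mem_domainD_of_norm_sub_lt ha fun i => by rw [add_sub_cancel_left]; exact hy i
    -- `f` and the sum of `G` are both limits of the same ratios, so they agree on the polydisc.
    exact tendsto_nhds_unique (tendsto_of_norm_sub_le_inv_prime_pow (hf _ hz))
      (tendsto_of_norm_sub_le_inv_prime_pow (hG y hy))
  · refine tendsto_nhds_unique (tendsto_of_norm_sub_le_inv_prime_pow (hf z hz)).norm ?_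
    simp_rw [norm_ratioT_eq_one hp _ hz]
    exact tendsto_const_nhds
  · exact tendsto_nhds_unique
      (tendsto_of_norm_sub_le_inv_prime_pow (hf _ (one_zero_mem_domainD hp hx)))
      (tendsto_ratioT_one_zero hp hx)
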